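/- An ordered graph is a finite simple graph whose vertex set is linearly ordered. Let $P_n$ denote the monotone increasing path with $n$ edges, i.e. a copy of $P_n$ in an ordered graph consists of $n+1$ vertices $v_0<v_1<\dots<v_n$ such that $v_{i}v_{i+1}$ is an edge for every $0\le i<n$. For $n,q\ge 1$ let $\tilde r(P_n;q)$, the $q$-color ordered size Ramsey number of $P_n$, be the minimum number of edges in an ordered graph $G$ such that every coloring of the edges of $G$ with $q$ colors contains a monochromatic copy of $P_n$. Then there exists an absolute constant $C>0$ such that for all integers $n\ge 2$ and $q\ge 2$, \[ \frac{n^{2q-1}}{2^{2q-1}(q-1)!}\ \le\ \tilde r(P_n;q)\ \le\ C\,n^{2q-1}(\log n)^3, \] where $\log$ is the natural logarithm. -/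

import Mathlib

/-- The subgraph relation for the ordered path with `n` edges: the graph `G` on the linearly ordered
vertex set `{0 < 1 < ... < N - 1}` contains vertices `φ 0 < φ 1 < ... < φ n` such that any two
consecutive ones are adjacent in `G`. -/
def ContainsOrderedPath {N : ℕ} (G : SimpleGraph (Fin N)) (n : ℕ) : Prop :=
  ∃ φ : Fin (n + 1) → Fin N, StrictMono φ ∧ ∀ i : Fin n, G.Adj (φ i.castSucc) (φ i.succ)

/-- Every colouring of the edges of the ordered graph `G` with `q` colours contains a
monochromatic ordered path with `n` edges. -/
def ArrowsOrderedPath {N : ℕ} (G : SimpleGraph (Fin N)) (n q : ℕ) : Prop :=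
  ∀ χ : G.EdgeLabeling (Fin q), ∃ c : Fin q, ContainsOrderedPath (χ.labelGraph c) n

/-- The `q`-colour ordered size Ramsey number of the ordered path with `n` edges: the minimum
number of edges of an ordered graph each of whose edge colourings with `q` colours contains a
monochromatic ordered path with `n` edges. -/
noncomputable def orderedSizeRamsey (n q : ℕ) : ℕ :=
  sInf {m : ℕ | ∃ (N : ℕ) (G : SimpleGraph (Fin N)),
    ArrowsOrderedPath G n q ∧ G.edgeSet.ncard = m}

/-! A `q`-colouring without a monochromatic path of `n` edges amounts to a map `f` from the vertices
to `[n]^q` such that some coordinate increases along every edge: longest-path lengths give the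
coordinates, and an increasing coordinate gives the colour. Both bounds are statements about such
maps.

Lower bound (`ArrowsOrderedPath.mul_le_ncard_edgeSet`): write `n = k + 1 + b`. With few edges, at
most `b^q` vertices have many earlier neighbours; they are placed in a translate of `[b]^q` in
increasing order. The others are coloured greedily by the antichain of points with coordinate sum
`k`, where being distinct is enough. The translations take care of edges between the two classes.

Upper bound (`exists_arrowsOrderedPath`): on `N = 4n^q` vertices take all pairs at distance at most
`4n^(q-1)`, plus a set of longer pairs that contains, for every `f` surviving the short edges, a
pair on which `f` weakly decreases. Give a pair `(a, b)` weight `1/(b - a)`. The long pairs weigh at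
most `N log n` in total, while those on which a surviving `f` weakly decreases weigh at least
`qn/16` (`le_sum_farPairs`). Hitting all of the at most `n^(qN)` maps greedily costs at most `256
n^(2q-1) (log n)^2 + 1` long pairs, one logarithm better than required. -/

/-! ### Colourings as separating maps -/

/-- A vertex map into `ℕ ^ q` such that along each edge some coordinate increases. -/
def IsSeparating {N q : ℕ} (G : SimpleGraph (Fin N)) (f : Fin N → Fin q → ℕ) : Prop :=
  ∀ u v, u < v → G.Adj u v → ∃ c, f u c < f v c

theorem IsSeparating.not_arrows {N n q : ℕ} {G : SimpleGraph (Fin N)} {f : Fin N → Fin q → ℕ}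
    (hf : IsSeparating G f) (hn : ∀ v c, f v c < n) : ¬ ArrowsOrderedPath G n q := by
  classical
  intro harr
  have h : ∀ e : G.edgeSet, ∃ c : Fin q, ∀ u v : Fin N, e.1 = s(u, v) → u < v → f u c < f v c := by
    rintro ⟨e, he⟩
    induction e using Sym2.ind with
    | _ x y =>
      have hxy : G.Adj x y := he
      rcases lt_or_gt_of_ne hxy.ne with hlt | hlt
      · obtain ⟨c, hc⟩ := hf x y hlt hxy
        refine ⟨c, fun u v huv hlt' => ?_⟩
        rcases Sym2.eq_iff.1 huv with ⟨rfl, rfl⟩ | ⟨rfl, rfl⟩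
        · exact hc
        · exact absurd hlt hlt'.asymm
      · obtain ⟨c, hc⟩ := hf y x hlt hxy.symm
        refine ⟨c, fun u v huv hlt' => ?_⟩
        rcases Sym2.eq_iff.1 huv with ⟨rfl, rfl⟩ | ⟨rfl, rfl⟩
        · exact absurd hlt hlt'.asymm
        · exact hc
  choose χ hχ using h
  obtain ⟨c, φ, hφ, hadj⟩ := harr χ
  have key : ∀ i : ℕ, ∀ hi : i < n + 1, i ≤ f (φ ⟨i, hi⟩) c := by
    intro i
    induction i with
    | zero => intro _; exact Nat.zero_le _
    | succ i ih =>
      intro hi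
      have hi' : i < n := by omega
      obtain ⟨H, hc⟩ := (SimpleGraph.EdgeLabeling.labelGraph_adj _ _).1 (hadj ⟨i, hi'⟩)
      have hlt := hχ ⟨_, H⟩ _ _ rfl (hφ (Fin.castSucc_lt_succ (i := (⟨i, hi'⟩ : Fin n))))
      rw [hc] at hlt
      exact lt_of_le_of_lt (ih (by omega)) hlt
  exact absurd (key n (by omega)) (not_le.2 (hn _ _))

/-- There is an increasing path with `m` edges that ends in `v`. -/
def HasPathTo {N : ℕ} (G : SimpleGraph (Fin N)) : ℕ → Fin N → Prop
  | 0, _ => True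
  | m + 1, v => ∃ u, u < v ∧ G.Adj u v ∧ HasPathTo G m u

theorem HasPathTo.exists_path {N : ℕ} {G : SimpleGraph (Fin N)} :
    ∀ {m : ℕ} {v : Fin N}, HasPathTo G m v →
      ∃ φ : Fin (m + 1) → Fin N, StrictMono φ ∧ (∀ i : Fin m, G.Adj (φ i.castSucc) (φ i.succ)) ∧
        φ (Fin.last m) = v
  | 0, v, _ => ⟨fun _ => v, fun i j hij => by have := i.2; have := j.2; simp only [Fin.lt_def] at hij; omega,
      fun i => i.elim0, rfl⟩
  | m + 1, v, ⟨u, huv, hadj, hu⟩ => by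
    obtain ⟨φ, hφ, hφadj, hlast⟩ := hu.exists_path
    refine ⟨Fin.snoc φ v, ?_, ?_, by simp⟩
    · rw [Fin.strictMono_iff_lt_succ]
      intro i
      refine Fin.lastCases ?_ (fun j => ?_) i
      · rw [Fin.snoc_castSucc, hlast, Fin.succ_last, Fin.snoc_last]; exact huv
      · rw [Fin.snoc_castSucc, Fin.succ_castSucc, Fin.snoc_castSucc]
        exact hφ Fin.castSucc_lt_succ
    · intro i
      refine Fin.lastCases ?_ (fun j => ?_) i
      · rw [Fin.snoc_castSucc, hlast, Fin.succ_last, Fin.snoc_last]; exact hadj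
      · rw [Fin.snoc_castSucc, Fin.succ_castSucc, Fin.snoc_castSucc]
        exact hφadj j

/-- Coordinate `c` at `v` is the length of the longest increasing path of colour `c` ending in `v`;
an edge of colour `c` extends such a path. -/
theorem exists_isSeparating_of_not_arrows {N n q : ℕ} {G : SimpleGraph (Fin N)}
    (h : ¬ ArrowsOrderedPath G n q) :
    ∃ f : Fin N → Fin q → ℕ, (∀ v c, f v c < n) ∧ IsSeparating G f := by
  classical
  unfold ArrowsOrderedPath at h
  push Not at h
  obtain ⟨χ, hχ⟩ := h
  have hno : ∀ c v, ¬ HasPathTo (χ.labelGraph c) n v := fun c v hv => by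
    obtain ⟨φ, h1, h2, -⟩ := hv.exists_path
    exact hχ c ⟨φ, h1, h2⟩
  have hspec : ∀ v c, HasPathTo (χ.labelGraph c)
      (Nat.findGreatest (fun m => HasPathTo (χ.labelGraph c) m v) n) v := fun v c =>
    Nat.findGreatest_spec (P := fun m => HasPathTo (χ.labelGraph c) m v) (Nat.zero_le n) trivial
  have hlt : ∀ v c, Nat.findGreatest (fun m => HasPathTo (χ.labelGraph c) m v) n < n := by
    intro v c
    refine lt_of_le_of_ne (Nat.findGreatest_le n) fun heq => hno c v ?_
    have := hspec v c
    rwa [heq] at this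
  refine ⟨fun v c => Nat.findGreatest (fun m => HasPathTo (χ.labelGraph c) m v) n, hlt, ?_⟩
  intro u v huv hadj
  refine ⟨χ.get u v hadj, ?_⟩
  refine Nat.le_findGreatest (hlt u _) ⟨u, huv, ?_, hspec u _⟩
  exact (SimpleGraph.EdgeLabeling.labelGraph_adj _ _).2 ⟨hadj, rfl⟩

/-! ### Lower bound -/

theorem SimpleGraph.card_filter_adj_le_ncard_edgeSet {N : ℕ} (G : SimpleGraph (Fin N))
    [DecidableRel G.Adj] :
    (Finset.univ.filter fun p : Fin N × Fin N => p.1 < p.2 ∧ G.Adj p.1 p.2).card ≤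
      G.edgeSet.ncard := by
  classical
  rw [← Set.ncard_coe_finset, ← Set.InjOn.ncard_image (f := fun p : Fin N × Fin N => s(p.1, p.2))]
  · refine Set.ncard_le_ncard ?_ (Set.toFinite _)
    rintro _ ⟨p, hp, rfl⟩
    exact (Finset.mem_filter.1 (Finset.mem_coe.1 hp)).2.2
  · rintro ⟨a, b⟩ hp ⟨c, d⟩ hq h
    have h1 := (Finset.mem_filter.1 (Finset.mem_coe.1 hp)).2.1
    have h2 := (Finset.mem_filter.1 (Finset.mem_coe.1 hq)).2.1
    rcases Sym2.eq_iff.1 h with ⟨rfl, rfl⟩ | ⟨rfl, rfl⟩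
    · rfl
    · exact absurd h1 h2.asymm

/-- The neighbours of `v` that precede `v`. -/
def SimpleGraph.backNeighbors {N : ℕ} (G : SimpleGraph (Fin N)) [DecidableRel G.Adj] (v : Fin N) :
    Finset (Fin N) :=
  Finset.univ.filter fun u => u < v ∧ G.Adj u v

theorem SimpleGraph.mul_card_le_ncard_edgeSet {N a : ℕ} (G : SimpleGraph (Fin N))
    [DecidableRel G.Adj] :
    a * (Finset.univ.filter fun v => a ≤ (G.backNeighbors v).card).card ≤ G.edgeSet.ncard := by
  classical
  refine le_trans ?_ G.card_filter_adj_le_ncard_edgeSet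
  set H := Finset.univ.filter fun v => a ≤ (G.backNeighbors v).card
  calc a * H.card = ∑ v ∈ H, a := by simp [mul_comm]
    _ ≤ ∑ v ∈ H, (G.backNeighbors v).card :=
        Finset.sum_le_sum fun v hv => (Finset.mem_filter.1 hv).2
    _ ≤ ∑ v, (G.backNeighbors v).card :=
        Finset.sum_le_univ_sum_of_nonneg fun _ => Nat.zero_le _
    _ = (Finset.univ.sigma fun v => G.backNeighbors v).card := by rw [Finset.card_sigma]
    _ ≤ _ := by
        refine Finset.card_le_card_of_injOn (fun x => (x.2, x.1)) ?_ ?_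
        · rintro ⟨v, u⟩ h
          simpa [SimpleGraph.backNeighbors] using h
        · rintro ⟨v, u⟩ _ ⟨v', u'⟩ _ h
          simp only [Prod.mk.injEq] at h
          obtain ⟨rfl, rfl⟩ := h
          rfl

/-- Greedy colouring from left to right. -/
theorem SimpleGraph.exists_greedy_coloring {N : ℕ} (G : SimpleGraph (Fin N)) [DecidableRel G.Adj]
    {α : Type*} [Nonempty α] (A : Finset α) :
    ∃ c : Fin N → α, ∀ v, (G.backNeighbors v).card < A.card →
      c v ∈ A ∧ ∀ u ∈ G.backNeighbors v, c u ≠ c v := by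
  classical
  have step : ∀ (v : Fin N) (c : ∀ u : Fin N, u < v → α), ∃ x : α,
      (G.backNeighbors v).card < A.card →
        x ∈ A ∧ ∀ u, ∀ hu : u < v, G.Adj u v → c u hu ≠ x := by
    intro v c
    by_cases h : (G.backNeighbors v).card < A.card
    · have hlt : ((G.backNeighbors v).attach.image fun u =>
          c u.1 (Finset.mem_filter.1 u.2).2.1).card < A.card :=
        lt_of_le_of_lt Finset.card_image_le (by simpa using h)
      obtain ⟨x, hxA, hx⟩ := Finset.exists_mem_notMem_of_card_lt_card hlt
      refine ⟨x, fun _ => ⟨hxA, fun u hu hadj heq => hx ?_⟩⟩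
      refine Finset.mem_image.2 ⟨⟨u, Finset.mem_filter.2 ⟨Finset.mem_univ _, hu, hadj⟩⟩, ?_, heq⟩
      exact Finset.mem_attach _ _
    · exact ⟨Classical.arbitrary α, fun h' => absurd h' h⟩
  choose F hF using step
  have wf : WellFounded (fun u v : Fin N => u < v) := wellFounded_lt
  refine ⟨wf.fix F, fun v hv => ?_⟩
  have := hF v (fun u _ => wf.fix F u) hv
  rw [← wf.fix_eq F v] at this
  exact ⟨this.1, fun u hu => this.2 u (Finset.mem_filter.1 hu).2.1 (Finset.mem_filter.1 hu).2.2⟩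

/-- Up to `b ^ q` vertices can be labelled by points of `[b] ^ q` along a linear extension. -/
theorem exists_digits {N : ℕ} (H : Finset (Fin N)) (b q : ℕ) (hH : H.card ≤ b ^ q) :
    ∃ δ : Fin N → Fin q → ℕ, (∀ v ∈ H, ∀ i, δ v i < b) ∧
      ∀ u ∈ H, ∀ v ∈ H, u < v → ∃ i, δ u i < δ v i := by
  classical
  have hrank : ∀ v ∈ H, (H.filter (· < v)).card < b ^ q := fun v hv =>
    lt_of_lt_of_le (Finset.card_lt_card (Finset.filter_ssubset.2 ⟨v, hv, lt_irrefl v⟩)) hH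
  refine ⟨fun v i => if hv : v ∈ H then finFunctionFinEquiv.symm ⟨_, hrank v hv⟩ i else 0, ?_, ?_⟩
  · intro v hv i
    simp only [hv, dif_pos]
    exact Fin.is_lt _
  · intro u hu v hv huv
    by_contra! hcon
    simp only [hu, hv, dif_pos] at hcon
    -- The labels are the base-`b` digits of the rank in `H`; if every digit weakly decreases, so
    -- does the rank.
    have h1 : (finFunctionFinEquiv (finFunctionFinEquiv.symm
        (⟨_, hrank v hv⟩ : Fin (b ^ q))) : ℕ) ≤
        (finFunctionFinEquiv (finFunctionFinEquiv.symm (⟨_, hrank u hu⟩ : Fin (b ^ q))) : ℕ) := by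
      rw [finFunctionFinEquiv_apply, finFunctionFinEquiv_apply]
      exact Finset.sum_le_sum fun i _ => Nat.mul_le_mul_right _ (hcon i)
    simp only [Equiv.apply_symm_apply] at h1
    refine absurd h1 (not_le.2 (Finset.card_lt_card ?_))
    refine (Finset.ssubset_iff_of_subset ?_).2 ⟨u, ?_, ?_⟩
    · intro w hw
      simp only [Finset.mem_filter] at hw ⊢
      exact ⟨hw.1, hw.2.trans huv⟩
    · simp [hu, huv]
    · simp

theorem ArrowsOrderedPath.mul_le_ncard_edgeSet {N q k b : ℕ} {G : SimpleGraph (Fin N)}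
    (h : ArrowsOrderedPath G (k + 1 + b) (q + 2)) :
    (k + q + 1).choose k * b ^ (q + 2) ≤ G.edgeSet.ncard := by
  classical
  set A : Finset (Fin (q + 2) →₀ ℕ) := Finset.univ.finsuppAntidiag k with hA
  have hAcard : A.card = (k + q + 1).choose k := by
    rw [hA, Finset.card_finsuppAntidiag_nat_eq_choose, Finset.card_univ, Fintype.card_fin]
    congr 1
    omega
  set H := Finset.univ.filter fun v => A.card ≤ (G.backNeighbors v).card with hH
  have hHm : A.card * H.card ≤ G.edgeSet.ncard := G.mul_card_le_ncard_edgeSet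
  by_contra! hlt
  have hHb : H.card ≤ b ^ (q + 2) := by
    by_contra! hcon
    have := Nat.mul_le_mul_left A.card hcon.le
    rw [hAcard] at this hHm
    omega
  obtain ⟨δ, hδb, hδ⟩ := exists_digits H b (q + 2) hHb
  obtain ⟨c, hc⟩ := G.exists_greedy_coloring A
  have hlow : ∀ v ∉ H, c v ∈ A ∧ ∀ u ∈ G.backNeighbors v, c u ≠ c v := fun v hv =>
    hc v (by simpa [hH] using hv)
  have hsum : ∀ v ∉ H, ∑ i, c v i = k := fun v hv =>
    (Finset.mem_finsuppAntidiag.1 (hlow v hv).1).1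
  have hcle : ∀ v ∉ H, ∀ i, c v i ≤ k := fun v hv i => by
    rw [← hsum v hv]
    exact Finset.single_le_sum (f := fun i => c v i) (fun _ _ => Nat.zero_le _) (Finset.mem_univ i)
  -- The shift by `k + 1` in coordinate 0 beats every low value, so edges from low vertices into `H`
  -- increase there; the shift by `b` in coordinate 1 does the same for edges leaving `H`.
  let f : Fin N → Fin (q + 2) → ℕ := fun v i =>
    if v ∈ H then δ v i + (if i = 0 then k + 1 else 0) else c v i + (if i = 1 then b else 0)
  refine IsSeparating.not_arrows (f := f) (G := G) ?_ ?_ h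
  · intro u v huv hadj
    by_cases hu : u ∈ H <;> by_cases hv : v ∈ H
    · obtain ⟨i, hi⟩ := hδ u hu v hv huv
      exact ⟨i, by simp only [f, hu, hv, if_true]; omega⟩
    · refine ⟨1, ?_⟩
      have := hδb u hu 1
      simp [f, hu, hv]
      omega
    · refine ⟨0, ?_⟩
      have := hcle u hu 0
      simp [f, hu, hv]
      omega
    -- Comparable points with the same coordinate sum coincide, contradicting the greedy colouring.
    · by_contra! hcon
      have hle : ∀ i, c v i ≤ c u i := fun i => by
        have := hcon i
        simp only [f, hu, hv, if_false] at this
        omega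
      have heq : ∀ i ∈ Finset.univ, c v i = c u i :=
        (Finset.sum_eq_sum_iff_of_le fun i _ => hle i).1 ((hsum v hv).trans (hsum u hu).symm)
      refine (hlow v hv).2 u ?_ (Finsupp.ext fun i => (heq i (Finset.mem_univ i)).symm)
      simp [SimpleGraph.backNeighbors, huv, hadj]
  · intro v i
    by_cases hv : v ∈ H
    · have := hδb v hv i
      simp only [f, hv, if_true]
      split_ifs <;> omega
    · have := hcle v hv i
      simp only [f, hv, if_false]
      split_ifs <;> omega

/-- Only one factor is bounded by `k + 1`: for odd `n` the cruder `(k + 1)^(q + 1)` would be too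
small for large `q`. -/
theorem mul_pow_le_choose_mul_factorial (k q : ℕ) :
    (k + 1) * (k + 2) ^ q ≤ (k + q + 1).choose k * (q + 1).factorial := by
  have h : (k + q + 1).choose k * (q + 1).factorial = (k + 1).ascFactorial (q + 1) := by
    rw [Nat.ascFactorial_eq_factorial_mul_choose, mul_comm,
      ← Nat.choose_symm_of_eq_add (n := k + q + 1) (a := q + 1) (b := k) (by ring)]
    congr 2
  rw [h, add_comm q 1, ← Nat.ascFactorial_mul_ascFactorial]
  simpa [Nat.ascFactorial_succ] using
    Nat.mul_le_mul_left (k + 1) (Nat.pow_succ_le_ascFactorial (k + 2) q)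

theorem half_pow_le_choose_mul_pow {n q : ℕ} (hn : 2 ≤ n) :
    (n : ℝ) ^ (2 * q + 3) / (2 ^ (2 * q + 3) * ((q + 1).factorial : ℝ)) ≤
      (((n / 2 - 1) + q + 1).choose (n / 2 - 1) * (n - n / 2) ^ (q + 2) : ℕ) := by
  obtain ⟨k, hk⟩ : ∃ k, n / 2 = k + 1 := ⟨n / 2 - 1, by omega⟩
  have hfac : (0 : ℝ) < ((q + 1).factorial : ℝ) := by positivity
  rw [hk, Nat.add_sub_cancel, ← div_div, ← div_pow, div_le_iff₀ hfac]
  have hmain : ((n : ℝ) / 2) ^ (2 * q + 3) ≤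
      (((k + 1) * (k + 2) ^ q * (n - (k + 1)) ^ (q + 2) : ℕ) : ℝ) := by
    rcases Nat.even_or_odd' n with ⟨m, rfl | rfl⟩
    · obtain rfl : m = k + 1 := by omega
      have : 2 * (k + 1) - (k + 1) = k + 1 := by omega
      rw [this]
      push_cast
      have h1 : ((k : ℝ) + 1) ^ q ≤ (k + 2) ^ q := by gcongr; norm_num
      calc (2 * ((k : ℝ) + 1) / 2) ^ (2 * q + 3) = (k + 1) * (k + 1) ^ q * (k + 1) ^ (q + 2) := by
            rw [mul_div_cancel_left₀ _ two_ne_zero]; ring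
        _ ≤ _ := by gcongr
    · obtain rfl : m = k + 1 := by omega
      have : 2 * (k + 1) + 1 - (k + 1) = k + 2 := by omega
      rw [this]
      push_cast
      have hk0 : (0 : ℝ) ≤ k := Nat.cast_nonneg k
      -- The single factor `k + 1 < n/2` is compensated by two factors `k + 2 > n/2`.
      have h3 : (((2 : ℝ) * (k + 1) + 1) / 2) ^ 3 ≤ (k + 1) * (k + 2) ^ 2 := by nlinarith
      have h1 : (((2 : ℝ) * (k + 1) + 1) / 2) ^ (2 * q) ≤ (k + 2) ^ (2 * q) := by
        gcongr; linarith
      calc (((2 : ℝ) * (k + 1) + 1) / 2) ^ (2 * q + 3)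
          = ((2 * (k + 1) + 1) / 2) ^ (2 * q) * ((2 * (k + 1) + 1) / 2) ^ 3 := by rw [pow_add]
        _ ≤ (k + 2) ^ (2 * q) * ((k + 1) * (k + 2) ^ 2) := by gcongr
        _ = _ := by ring
  refine hmain.trans ?_
  have h2 := mul_pow_le_choose_mul_factorial k q
  rw [← Nat.cast_mul]
  refine Nat.cast_le.2 ?_
  calc _ ≤ (k + q + 1).choose k * (q + 1).factorial * (n - (k + 1)) ^ (q + 2) :=
        Nat.mul_le_mul_right _ h2
    _ = _ := by ring

/-! ### Weighted inversions of a sequence -/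

/-- One-sided maximal inequality: a finite set of integers in `[0, N)` has at most `N / K` points
from which some later point is reached through a stretch of density less than `1 / K`. -/
theorem mul_card_sparse_le {N : ℕ} (T : Finset (Fin N)) (K : ℕ) :
    K * (T.filter fun a => ∃ b ∈ T, a < b ∧
      K * (T.filter fun c => a < c ∧ c ≤ b).card < (b : ℕ) - a).card ≤ N := by
  classical
  set S := T.filter fun a => ∃ b ∈ T, a < b ∧
      K * (T.filter fun c => a < c ∧ c ≤ b).card < (b : ℕ) - a with hS
  -- Scan from the left: at a point of `S`, jump to its witness `b`, charging the points skipped to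
  -- the stretch `[a, b)`.
  have key : ∀ k x : ℕ, x + k = N → K * (S.filter fun a : Fin N => x ≤ (a : ℕ)).card ≤ k := by
    intro k
    induction k using Nat.strong_induction_on with
    | _ k ih =>
      intro x hx
      by_cases hmem : ∃ a ∈ S, (a : ℕ) = x
      · obtain ⟨a, haS, rfl⟩ := hmem
        obtain ⟨haT, b, hbT, hab, hlt⟩ := Finset.mem_filter.1 haS
        have hab' : (a : ℕ) < b := hab
        have hb := b.2
        have hrec := ih (N - b) (by omega) b (by omega)
        have hsub : (S.filter fun c : Fin N => (a : ℕ) ≤ c) ⊆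
            (S.filter fun c : Fin N => (b : ℕ) ≤ c) ∪ T.filter fun c => a ≤ c ∧ c < b := by
          intro c hc
          simp only [Finset.mem_union, Finset.mem_filter] at hc ⊢
          by_cases hcb : (b : ℕ) ≤ c
          · exact Or.inl ⟨hc.1, hcb⟩
          · exact Or.inr ⟨(Finset.mem_filter.1 hc.1).1, hc.2, not_le.1 hcb⟩
        have hcard : (T.filter fun c => a ≤ c ∧ c < b).card =
            (T.filter fun c => a < c ∧ c ≤ b).card := by
          have h1 : (T.filter fun c => a ≤ c ∧ c < b) =
              insert a (T.filter fun c => a < c ∧ c < b) := by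
            ext c
            simp only [Finset.mem_insert, Finset.mem_filter]
            grind
          have h2 : (T.filter fun c => a < c ∧ c ≤ b) =
              insert b (T.filter fun c => a < c ∧ c < b) := by
            ext c
            simp only [Finset.mem_insert, Finset.mem_filter]
            grind
          rw [h1, h2, Finset.card_insert_of_notMem (by simp),
            Finset.card_insert_of_notMem (by simp)]
        have h3 := (Finset.card_le_card hsub).trans (Finset.card_union_le _ _)
        have h4 := Nat.mul_le_mul_left K h3
        rw [Nat.mul_add, hcard] at h4
        omega
      · rcases k with _ | k
        · rw [Finset.filter_false_of_mem]
          · simp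
          · intro a _
            have := a.2
            omega
        · have hrec := ih k (by omega) (x + 1) (by omega)
          have : (S.filter fun a : Fin N => x ≤ (a : ℕ)) = S.filter fun a : Fin N => x + 1 ≤ (a : ℕ) := by
            refine Finset.filter_congr fun a ha => ⟨fun h => ?_, fun h => by omega⟩
            exact lt_of_le_of_ne h fun h' => hmem ⟨a, ha, h'.symm⟩
          rw [this]
          omega
  simpa using key N 0 (by omega)

/-- The weight `1 / (b - a)` of a strict inversion `(a, b)` of `g`. -/
noncomputable def inversionWeight {N : ℕ} (g : Fin N → ℕ) (a b : Fin N) : ℝ :=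
  if a < b ∧ g b < g a then 1 / ((b : ℝ) - a) else 0

theorem inversionWeight_nonneg {N : ℕ} (g : Fin N → ℕ) (a b : Fin N) :
    0 ≤ inversionWeight g a b := by
  unfold inversionWeight
  split_ifs with h
  · have : (a : ℝ) < b := by exact_mod_cast h.1
    exact div_nonneg zero_le_one (by linarith)
  · exact le_rfl

theorem card_mul_le_of_spaced {N D : ℕ} (S : Finset (Fin N)) (a b : Fin N) (hD : 0 < D)
    (hS : ∀ c ∈ S, c ≤ b ∧ (a : ℕ) + D < c)
    (hsp : ∀ c ∈ S, ∀ d ∈ S, c < d → (c : ℕ) + D < d) : S.card * D ≤ (b : ℕ) - a := by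
  have h : S.card ≤ (Finset.Icc 1 (((b : ℕ) - a) / D)).card := by
    refine Finset.card_le_card_of_injOn (fun c => ((c : ℕ) - a) / D) ?_ ?_
    · intro c hc
      obtain ⟨h1, h2⟩ := hS c hc
      have h1' : (c : ℕ) ≤ b := h1
      simp only [Finset.coe_Icc, Set.mem_Icc]
      exact ⟨(Nat.le_div_iff_mul_le hD).2 (by omega), Nat.div_le_div_right (by omega)⟩
    · intro c hc d hd hcd
      simp only at hcd
      by_contra hne
      wlog hlt : c < d generalizing c d
      · exact this hd hc hcd.symm (Ne.symm hne) (lt_of_le_of_ne (not_lt.1 hlt) (Ne.symm hne))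
      have h1 := hsp c hc d hd hlt
      have h2 := (hS c hc).2
      have h3 : ((c : ℕ) - a) / D + 1 ≤ ((d : ℕ) - a) / D := by
        rw [← Nat.add_div_right _ hD]
        exact Nat.div_le_div_right (by omega)
      omega
  rw [Nat.card_Icc, Nat.add_sub_cancel] at h
  exact (Nat.mul_le_mul_right D h).trans (Nat.div_mul_le_self _ _)

/-- Points of `T` in `(a, b]` at the level `g a` are more than `4B` apart, so they make up at most
half of the count guaranteed by density. Each remaining point is below `g a`, an inversion with `a`,
or above `g a ≥ g b`, an inversion with `b`, and has weight at least `1/(b - a)`. -/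
theorem inv_le_sum_inversionWeight_add {N B : ℕ} (hB : 0 < B) (T : Finset (Fin N))
    (g : Fin N → ℕ)
    (hclose : ∀ a ∈ T, ∀ b ∈ T, a < b → g b ≤ g a → (a : ℕ) + 4 * B < b)
    {a b : Fin N} (ha : a ∈ T) (hab : a < b) (hg : g b ≤ g a)
    (hdense : (b : ℕ) - a ≤ 2 * B * (T.filter fun c => a < c ∧ c ≤ b).card) :
    1 / (4 * B : ℝ) ≤ ∑ c ∈ T, inversionWeight g a c + ∑ c ∈ T, inversionWeight g c b := by
  classical
  set C := T.filter fun c => a < c ∧ c ≤ b with hC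
  have hsame : (C.filter fun c => g c = g a).card * (4 * B) ≤ (b : ℕ) - a := by
    refine card_mul_le_of_spaced _ a b (by omega) ?_ ?_
    · intro c hc
      simp only [hC, Finset.mem_filter] at hc
      exact ⟨hc.1.2.2, hclose a ha c hc.1.1 hc.1.2.1 hc.2.le⟩
    · intro c hc d hd hcd
      simp only [hC, Finset.mem_filter] at hc hd
      exact hclose c hc.1.1 d hd.1.1 hcd (hd.2.trans hc.2.symm).le
  have hcard : C.card = (C.filter fun c => g c = g a).card +
      ((C.filter fun c => g c < g a).card + (C.filter fun c => g a < g c).card) := by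
    rw [← Finset.card_union_of_disjoint, ← Finset.filter_or,
      ← Finset.card_filter_add_card_filter_not (s := C) (fun c => g c = g a)]
    · congr 2
      exact Finset.filter_congr fun c _ => by omega
    · exact Finset.disjoint_filter.2 fun c _ h1 h2 => by omega
  have hab' : (a : ℕ) < b := hab
  have hpos : (0 : ℝ) < (b : ℝ) - a := by
    have : (a : ℝ) < b := by exact_mod_cast hab'
    linarith
  have hbig : (b : ℕ) - a ≤ 4 * B *
      ((C.filter fun c => g c < g a).card + (C.filter fun c => g a < g c).card) := by
    rw [hcard] at hdense
    nlinarith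
  have hbigR : (b : ℝ) - a ≤ 4 * B *
      (((C.filter fun c => g c < g a).card : ℝ) + (C.filter fun c => g a < g c).card) := by
    have : (((b : ℕ) - a : ℕ) : ℝ) ≤ ((4 * B *
      ((C.filter fun c => g c < g a).card + (C.filter fun c => g a < g c).card) : ℕ) : ℝ) :=
      Nat.cast_le.2 hbig
    rw [Nat.cast_sub hab'.le] at this
    push_cast at this
    exact this
  have hout : ((C.filter fun c => g c < g a).card : ℝ) * (1 / ((b : ℝ) - a)) ≤
      ∑ c ∈ T, inversionWeight g a c := by
    rw [← nsmul_eq_mul, ← Finset.sum_const]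
    refine le_trans (Finset.sum_le_sum fun c hc => ?_) (Finset.sum_le_sum_of_subset_of_nonneg
      (t := T) (fun c hc => ?_) fun c _ _ => inversionWeight_nonneg g a c)
    · simp only [hC, Finset.mem_filter] at hc
      rw [inversionWeight, if_pos ⟨hc.1.2.1, hc.2⟩]
      have h1 : (a : ℝ) < c := by exact_mod_cast hc.1.2.1
      have h2 : (c : ℝ) ≤ b := by exact_mod_cast hc.1.2.2
      exact one_div_le_one_div_of_le (by linarith) (by linarith)
    · simp only [hC, Finset.mem_filter] at hc
      exact hc.1.1
  have hin : ((C.filter fun c => g a < g c).card : ℝ) * (1 / ((b : ℝ) - a)) ≤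
      ∑ c ∈ T, inversionWeight g c b := by
    rw [← nsmul_eq_mul, ← Finset.sum_const]
    refine le_trans (Finset.sum_le_sum fun c hc => ?_) (Finset.sum_le_sum_of_subset_of_nonneg
      (t := T) (fun c hc => ?_) fun c _ _ => inversionWeight_nonneg g c b)
    · simp only [hC, Finset.mem_filter] at hc
      have hcb : c < b := lt_of_le_of_ne hc.1.2.2 fun h => by
        have := hc.2
        rw [h] at this
        omega
      rw [inversionWeight, if_pos ⟨hcb, lt_of_le_of_lt hg hc.2⟩]
      have h1 : (a : ℝ) < c := by exact_mod_cast hc.1.2.1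
      have h2 : (c : ℝ) < b := by exact_mod_cast hcb
      exact one_div_le_one_div_of_le (by linarith) (by linarith)
    · simp only [hC, Finset.mem_filter] at hc
      exact hc.1.1
  refine le_trans ?_ (add_le_add hout hin)
  have hB' : (0 : ℝ) < B := by exact_mod_cast hB
  rw [← add_mul, mul_one_div, div_le_div_iff₀ (by positivity) hpos]
  linarith

/-- Remove the at most `N/(2B)` points that start a sparse stretch and the points of weight at least
`1/(8B)`. On the rest `g` is strictly increasing by the previous lemma, so at most `n` points
remain. Hence many points are heavy; each inversion is counted at both ends. -/
theorem le_sum_inversionWeight {N n B : ℕ} (hB : 0 < B) (T : Finset (Fin N)) (g : Fin N → ℕ)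
    (hg : ∀ a ∈ T, g a < n)
    (hclose : ∀ a ∈ T, ∀ b ∈ T, a < b → g b ≤ g a → (a : ℕ) + 4 * B < b) :
    ((T.card : ℝ) - N / (2 * B) - n) / (16 * B) ≤
      ∑ a ∈ T, ∑ b ∈ T, inversionWeight g a b := by
  classical
  have hB' : (0 : ℝ) < B := by exact_mod_cast hB
  set S := T.filter fun a => ∃ b ∈ T, a < b ∧
      (2 * B) * (T.filter fun c => a < c ∧ c ≤ b).card < (b : ℕ) - a with hS
  have hSN : (S.card : ℝ) ≤ N / (2 * B) := by
    rw [le_div_iff₀ (by positivity), mul_comm]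
    exact_mod_cast mul_card_sparse_le T (2 * B)
  set w : Fin N → ℝ := fun a => ∑ c ∈ T, inversionWeight g a c + ∑ c ∈ T, inversionWeight g c a
    with hw
  have hout : ∀ a, 0 ≤ ∑ c ∈ T, inversionWeight g a c := fun a =>
    Finset.sum_nonneg fun c _ => inversionWeight_nonneg g a c
  have hin : ∀ a, 0 ≤ ∑ c ∈ T, inversionWeight g c a := fun a =>
    Finset.sum_nonneg fun c _ => inversionWeight_nonneg g c a
  set H := T.filter fun a => 1 / (8 * B : ℝ) ≤ w a with hH
  set L := (T \ S) \ H with hL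
  have hLn : L.card ≤ n := by
    rw [← Finset.card_range n]
    refine Finset.card_le_card_of_injOn g (fun a ha => ?_) fun a ha b hb hab => ?_
    · simp only [hL, Finset.coe_sdiff] at ha
      simpa using hg a ha.1.1
    · by_contra hne
      wlog hlt : a < b generalizing a b
      · exact this b hb a ha hab.symm (Ne.symm hne) (lt_of_le_of_ne (not_lt.1 hlt) (Ne.symm hne))
      have ha' : (a ∈ T ∧ a ∉ S) ∧ a ∉ H := by simpa [hL] using ha
      have hb' : (b ∈ T ∧ b ∉ S) ∧ b ∉ H := by simpa [hL] using hb
      have hdense : (b : ℕ) - a ≤ 2 * B * (T.filter fun c => a < c ∧ c ≤ b).card := by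
        by_contra hcon
        exact ha'.1.2 (Finset.mem_filter.2 ⟨ha'.1.1, b, hb'.1.1, hlt, not_le.1 hcon⟩)
      have h1 := inv_le_sum_inversionWeight_add hB T g hclose ha'.1.1 hlt hab.ge hdense
      have h2 : w a < 1 / (8 * B) := by
        by_contra hcon
        exact ha'.2 (Finset.mem_filter.2 ⟨ha'.1.1, not_lt.1 hcon⟩)
      have h3 : w b < 1 / (8 * B) := by
        by_contra hcon
        exact hb'.2 (Finset.mem_filter.2 ⟨hb'.1.1, not_lt.1 hcon⟩)
      have h4 : 1 / (4 * B : ℝ) = 1 / (8 * B) + 1 / (8 * B) := by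
        field_simp
        norm_num
      simp only [hw] at h2 h3
      linarith [hin a, hout b]
  have hcard : T.card ≤ S.card + H.card + L.card := by
    have h1 : T ⊆ (S ∪ H) ∪ L := by
      intro a ha
      simp only [hL, Finset.mem_union, Finset.mem_sdiff]
      tauto
    have h2 := (Finset.card_le_card h1).trans (Finset.card_union_le _ _)
    have h3 := Finset.card_union_le S H
    omega
  have hsum : ∑ a ∈ T, w a = 2 * ∑ a ∈ T, ∑ b ∈ T, inversionWeight g a b := by
    simp only [hw]
    rw [Finset.sum_add_distrib, Finset.sum_comm (f := fun a c => inversionWeight g c a)]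
    ring
  have hHw : (H.card : ℝ) * (1 / (8 * B)) ≤ ∑ a ∈ T, w a := by
    rw [← nsmul_eq_mul, ← Finset.sum_const]
    exact le_trans (Finset.sum_le_sum fun a ha => (Finset.mem_filter.1 ha).2)
      (Finset.sum_le_sum_of_subset_of_nonneg (Finset.filter_subset _ _)
        fun a _ _ => add_nonneg (hout a) (hin a))
  have hcardR : (T.card : ℝ) ≤ S.card + H.card + L.card := by exact_mod_cast hcard
  have hLR : (L.card : ℝ) ≤ n := by exact_mod_cast hLn
  calc ((T.card : ℝ) - N / (2 * B) - n) / (16 * B) ≤ (H.card : ℝ) / (16 * B) := by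
        gcongr
        linarith
    _ = (H.card : ℝ) * (1 / (8 * B)) / 2 := by field_simp; ring
    _ ≤ _ := by linarith

/-! ### Greedy hitting sets -/

/-- Double counting: an element drawn with probability proportional to `x` hits each member of `F`
with probability at least `W / X`. -/
theorem exists_hitting_step {α β : Type*} (E : Finset α) (x : α → ℝ) (hx : ∀ e ∈ E, 0 < x e)
    (F : Finset β) (r : β → α → Prop) [∀ f, DecidablePred (r f)] {W X : ℝ} (hW : 0 < W)
    (hX : ∑ e ∈ E, x e ≤ X) (hF : ∀ f ∈ F, W ≤ ∑ e ∈ E with r f e, x e) (hne : F.Nonempty) :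
    ∃ e ∈ E, W / X * F.card ≤ ((F.filter fun f => r f e).card : ℝ) := by
  classical
  obtain ⟨f₀, hf₀⟩ := hne
  have hWE : W ≤ ∑ e ∈ E, x e := (hF f₀ hf₀).trans
    (Finset.sum_le_sum_of_subset_of_nonneg (Finset.filter_subset _ _) fun e he _ => (hx e he).le)
  have hX0 : 0 < X := by linarith
  have hE : E.Nonempty := by
    rw [Finset.nonempty_iff_ne_empty]
    rintro rfl
    rw [Finset.sum_empty] at hWE
    linarith
  have hcount : ∑ e ∈ E, x e * ((F.filter fun f => r f e).card : ℝ) =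
      ∑ f ∈ F, ∑ e ∈ E with r f e, x e := by
    simp_rw [Finset.sum_filter]
    rw [Finset.sum_comm]
    refine Finset.sum_congr rfl fun e _ => ?_
    rw [← Finset.sum_filter, Finset.sum_const, nsmul_eq_mul, mul_comm]
  obtain ⟨e, he, hle⟩ := Finset.exists_le_of_sum_le hE
    (f := fun e => x e * (W / X * F.card))
    (g := fun e => x e * ((F.filter fun f => r f e).card : ℝ)) (by
      rw [hcount, ← Finset.sum_mul]
      calc (∑ e ∈ E, x e) * (W / X * F.card) ≤ X * (W / X * F.card) := by gcongr
        _ = ∑ f ∈ F, W := by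
            rw [Finset.sum_const, nsmul_eq_mul]
            field_simp
        _ ≤ _ := Finset.sum_le_sum hF)
  exact ⟨e, he, le_of_mul_le_mul_left hle (hx e he)⟩

/-- Greedy bound for hitting sets in terms of a fractional one. -/
theorem exists_card_missed_le {α β : Type*} (E : Finset α) (x : α → ℝ) (hx : ∀ e ∈ E, 0 < x e)
    (F : Finset β) (r : β → α → Prop) [∀ f, DecidablePred (r f)] {W X : ℝ} (hW : 0 < W)
    (hX : ∑ e ∈ E, x e ≤ X) (hF : ∀ f ∈ F, W ≤ ∑ e ∈ E with r f e, x e) (hWX : W ≤ X) (m : ℕ) :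
    ∃ S ⊆ E, S.card ≤ m ∧
      ((F.filter fun f => ∀ e ∈ S, ¬ r f e).card : ℝ) ≤ (1 - W / X) ^ m * F.card := by
  classical
  have hX0 : 0 < X := by linarith
  have h1 : 0 ≤ 1 - W / X := by
    rw [sub_nonneg, div_le_one hX0]
    exact hWX
  induction m with
  | zero => exact ⟨∅, Finset.empty_subset _, by simp, by simp⟩
  | succ m ih =>
    obtain ⟨S, hSE, hSm, hS⟩ := ih
    rcases (F.filter fun f => ∀ e ∈ S, ¬ r f e).eq_empty_or_nonempty with hemp | hne
    · refine ⟨S, hSE, by omega, ?_⟩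
      rw [hemp, Finset.card_empty, Nat.cast_zero]
      positivity
    · obtain ⟨e, he, hle⟩ := exists_hitting_step E x hx _ r hW hX
        (fun f hf => hF f (Finset.mem_filter.1 hf).1) hne
      refine ⟨insert e S, Finset.insert_subset he hSE,
        (Finset.card_insert_le _ _).trans (by omega), ?_⟩
      have hsplit := Finset.card_filter_add_card_filter_not
        (s := F.filter fun f => ∀ e ∈ S, ¬ r f e) (fun f => r f e)
      have hsub : (F.filter fun f => ∀ e' ∈ insert e S, ¬ r f e') =
          (F.filter fun f => ∀ e ∈ S, ¬ r f e).filter fun f => ¬ r f e := by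
        ext f
        simp only [Finset.mem_filter, Finset.forall_mem_insert]
        tauto
      rw [hsub]
      have hsplitR : (((F.filter fun f => ∀ e ∈ S, ¬ r f e).filter fun f => r f e).card : ℝ) +
          ((F.filter fun f => ∀ e ∈ S, ¬ r f e).filter fun f => ¬ r f e).card =
          (F.filter fun f => ∀ e ∈ S, ¬ r f e).card := by exact_mod_cast hsplit
      calc _ ≤ (1 - W / X) * ((F.filter fun f => ∀ e ∈ S, ¬ r f e).card : ℝ) := by linarith
        _ ≤ (1 - W / X) * ((1 - W / X) ^ m * F.card) := by gcongr
        _ = _ := by ring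

theorem exists_hitting_set {α β : Type*} (E : Finset α) (x : α → ℝ) (hx : ∀ e ∈ E, 0 < x e)
    (F : Finset β) (r : β → α → Prop) {W X Λ : ℝ} (hW : 0 < W) (hX : ∑ e ∈ E, x e ≤ X)
    (hF : ∀ f ∈ F, ∀ P : α → Prop, [DecidablePred P] → (∀ e, P e ↔ r f e) →
      W ≤ ∑ e ∈ E with P e, x e)
    (hΛ : Real.log F.card ≤ Λ) (hΛ0 : 0 ≤ X / W * Λ) :
    ∃ S ⊆ E, (S.card : ℝ) ≤ X / W * Λ + 1 ∧ ∀ f ∈ F, ∃ e ∈ S, r f e := by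
  classical
  rcases F.eq_empty_or_nonempty with rfl | ⟨f₀, hf₀⟩
  · exact ⟨∅, Finset.empty_subset _, by simpa using by linarith, by simp⟩
  have hWX : W ≤ X := ((hF f₀ hf₀ (r f₀) fun _ => Iff.rfl).trans
    (Finset.sum_le_sum_of_subset_of_nonneg (Finset.filter_subset _ _)
      fun e he _ => (hx e he).le)).trans hX
  have hX0 : 0 < X := by linarith
  have hFpos : (0 : ℝ) < F.card := by exact_mod_cast Finset.card_pos.2 ⟨f₀, hf₀⟩
  -- The extra step makes `m * (W / X) > Λ` strict, so fewer than one member is missed.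
  set m := ⌊X / W * Λ⌋₊ + 1 with hm
  obtain ⟨S, hSE, hSm, hS⟩ := exists_card_missed_le E x hx F r hW hX
    (fun f hf => hF f hf (r f) fun _ => Iff.rfl) hWX m
  refine ⟨S, hSE, ?_, ?_⟩
  · calc (S.card : ℝ) ≤ m := by exact_mod_cast hSm
      _ ≤ _ := by
        rw [hm]
        push_cast
        gcongr
        exact Nat.floor_le hΛ0
  · have hlt : ((F.filter fun f => ∀ e ∈ S, ¬ r f e).card : ℝ) < 1 := by
      refine hS.trans_lt ?_
      have hmΛ : X / W * Λ < m := by rw [hm]; push_cast; exact Nat.lt_floor_add_one _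
      have h1 : 1 - W / X ≤ Real.exp (-(W / X)) := by
        have := Real.add_one_le_exp (-(W / X))
        linarith
      have h0 : 0 ≤ 1 - W / X := by
        rw [sub_nonneg, div_le_one hX0]
        exact hWX
      calc (1 - W / X) ^ m * F.card ≤ Real.exp (-(W / X)) ^ m * Real.exp (Real.log F.card) := by
            rw [Real.exp_log hFpos]
            gcongr
        _ = Real.exp (m * (-(W / X)) + Real.log F.card) := by
            rw [← Real.exp_nat_mul, ← Real.exp_add]
        _ < 1 := by
            rw [Real.exp_lt_one_iff]
            have : Λ < m * (W / X) := by
              rw [div_mul_eq_mul_div, div_lt_iff₀ hW] at hmΛ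
              rw [mul_div_assoc', lt_div_iff₀ hX0]
              linarith
            linarith
    intro f hf
    by_contra! hcon
    have : 0 < (F.filter fun f => ∀ e ∈ S, ¬ r f e).card :=
      Finset.card_pos.2 ⟨f, Finset.mem_filter.2 ⟨hf, hcon⟩⟩
    have h2 : (F.filter fun f => ∀ e ∈ S, ¬ r f e).card < 1 := by exact_mod_cast hlt
    omega

/-! ### Total weight of the far pairs -/

theorem sum_Ico_inv_succ_le_log {D M : ℕ} (hD : 0 < D) (hDM : D ≤ M) :
    ∑ d ∈ Finset.Ico D M, 1 / ((d : ℝ) + 1) ≤ Real.log (M / D) := by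
  have hD' : (0 : ℝ) < D := by exact_mod_cast hD
  induction M, hDM using Nat.le_induction with
  | base => simp [div_self hD'.ne']
  | succ M hM ih =>
    have hM' : (0 : ℝ) < M := by exact_mod_cast hD.trans_le hM
    rw [Finset.sum_Ico_succ_top hM]
    have h1 := Real.one_sub_inv_le_log_of_pos (x := ((M : ℝ) + 1) / M) (by positivity)
    have h2 : 1 - (((M : ℝ) + 1) / M)⁻¹ = 1 / ((M : ℝ) + 1) := by
      field_simp
      ring
    have h3 : Real.log (((M + 1 : ℕ) : ℝ) / D) = Real.log (M / D) + Real.log ((M + 1) / M) := by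
      rw [← Real.log_mul (by positivity) (by positivity)]
      congr 1
      push_cast
      field_simp
    rw [h3]
    linarith

/-- The pairs of positions at distance greater than `D`. -/
def farPairs (N D : ℕ) : Finset (Fin N × Fin N) :=
  Finset.univ.filter fun e => (e.1 : ℕ) + D < e.2

theorem sum_farPairs_le {N D : ℕ} (hD : 0 < D) (hDN : D ≤ N) :
    ∑ e ∈ farPairs N D, 1 / ((e.2 : ℝ) - e.1) ≤ N * Real.log (N / D) := by
  classical
  rw [farPairs, Finset.sum_filter, Fintype.sum_prod_type]
  have h : ∀ u : Fin N, (∑ v : Fin N, if (u : ℕ) + D < v then 1 / ((v : ℝ) - u) else 0) ≤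
      Real.log (N / D) := by
    intro u
    refine le_trans ?_ (sum_Ico_inv_succ_le_log hD hDN)
    rw [← Finset.sum_filter]
    have hinj : Set.InjOn (fun v : Fin N => (v : ℕ) - u - 1)
        (Finset.univ.filter fun v : Fin N => (u : ℕ) + D < v) := by
      intro v hv w hw hvw
      simp only [Finset.coe_filter, Finset.mem_univ, true_and, Set.mem_ofPred_eq] at hv hw hvw
      ext
      omega
    calc ∑ v ∈ Finset.univ.filter fun v : Fin N => (u : ℕ) + D < v, 1 / ((v : ℝ) - u)
        = ∑ v ∈ Finset.univ.filter fun v : Fin N => (u : ℕ) + D < v,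
            1 / ((((v : ℕ) - u - 1 : ℕ) : ℝ) + 1) := by
          refine Finset.sum_congr rfl fun v hv => ?_
          have hv' : (u : ℕ) + D < v := (Finset.mem_filter.1 hv).2
          have : (v : ℕ) = ((v : ℕ) - u - 1) + 1 + u := by omega
          have h2 : (v : ℝ) = (((v : ℕ) - u - 1 : ℕ) : ℝ) + 1 + u := by exact_mod_cast this
          congr 1
          linarith
      _ = ∑ d ∈ (Finset.univ.filter fun v : Fin N => (u : ℕ) + D < v).image
            (fun v : Fin N => (v : ℕ) - u - 1), 1 / ((d : ℝ) + 1) := by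
          rw [Finset.sum_image hinj]
      _ ≤ _ := by
          refine Finset.sum_le_sum_of_subset_of_nonneg ?_ fun d _ _ => by positivity
          intro d hd
          obtain ⟨v, hv, rfl⟩ := Finset.mem_image.1 hd
          have hv' : (u : ℕ) + D < v := (Finset.mem_filter.1 hv).2
          have := v.2
          simp only [Finset.mem_Ico]
          omega
  calc _ ≤ ∑ u : Fin N, Real.log (N / D) := Finset.sum_le_sum fun u _ => h u
    _ = _ := by simp

theorem sum_sum_fiber {ι κ : Type*} [Fintype ι] [Fintype κ] [DecidableEq κ] (ζ : ι → κ)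
    (h : ι → ι → ℝ) :
    ∑ z, ∑ a with ζ a = z, ∑ b with ζ b = z, h a b =
      ∑ a, ∑ b, if ζ b = ζ a then h a b else 0 := by
  rw [← Finset.sum_fiberwise (s := Finset.univ) (g := ζ)
    (f := fun a => ∑ b, if ζ b = ζ a then h a b else 0)]
  refine Finset.sum_congr rfl fun z _ => Finset.sum_congr rfl fun a ha => ?_
  rw [(Finset.mem_filter.1 ha).2, ← Finset.sum_filter]

/-! ### Decreasing pairs on axis-parallel lines -/

section Lines

variable {N n p : ℕ} (f : Fin N → Fin (p + 1) → Fin n)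

/-- The coordinates of `f u` other than the `j`-th. -/
def lineIndex (j : Fin (p + 1)) (u : Fin N) : {i : Fin (p + 1) // i ≠ j} → Fin n :=
  fun i => f u i

/-- `f` never weakly decreases within distance `D`. -/
def LocallySeparating (D : ℕ) : Prop :=
  ∀ u v : Fin N, u < v → (v : ℕ) ≤ u + D → ¬ f v ≤ f u

variable {f}

theorem le_of_lineIndex_eq {j : Fin (p + 1)} {u v : Fin N} (h : lineIndex f j v = lineIndex f j u)
    (hj : f v j ≤ f u j) : f v ≤ f u := by
  intro i
  by_cases hi : i = j
  · rw [hi]; exact hj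
  · exact (congrFun h ⟨i, hi⟩).le

/-- Sum the bound for one line over the `B` lines in direction `j`: the numerators add up to `N -
N/2 - nB = nB`, since `N = 4nB`. -/
theorem div_le_sum_lines {B : ℕ} (hB : B = n ^ p) (hn : 0 < n) (hN : N = 4 * n ^ (p + 1))
    (hf : LocallySeparating f (4 * B)) (j : Fin (p + 1)) :
    (n : ℝ) / 16 ≤ ∑ a, ∑ b, if lineIndex f j b = lineIndex f j a then
      inversionWeight (fun u => (f u j : ℕ)) a b else 0 := by
  classical
  have hB0 : 0 < B := by rw [hB]; positivity
  have hBR : (0 : ℝ) < B := by exact_mod_cast hB0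
  rw [← sum_sum_fiber (lineIndex f j) (inversionWeight fun u => (f u j : ℕ))]
  have hline : ∀ z, (((Finset.univ.filter fun a => lineIndex f j a = z).card : ℝ) -
      N / (2 * B) - n) / (16 * B) ≤ ∑ a with lineIndex f j a = z,
        ∑ b with lineIndex f j b = z, inversionWeight (fun u => (f u j : ℕ)) a b := by
    intro z
    refine le_sum_inversionWeight hB0 _ _ (fun a _ => (f a j).2) fun a ha b hb hab hle => ?_
    by_contra hcon
    refine hf a b hab (not_lt.1 hcon) (le_of_lineIndex_eq (j := j) ?_ hle)
    rw [(Finset.mem_filter.1 ha).2, (Finset.mem_filter.1 hb).2]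
  refine le_trans (le_of_eq ?_) (Finset.sum_le_sum fun z _ => hline z)
  have hcardz : (Fintype.card ({i : Fin (p + 1) // i ≠ j} → Fin n) : ℝ) = B := by
    rw [Fintype.card_fun, Fintype.card_fin, Fintype.card_subtype_compl, Fintype.card_fin,
      Fintype.card_subtype_eq, Nat.add_sub_cancel, hB]
  have hcardT : ∑ z, ((Finset.univ.filter fun a => lineIndex f j a = z).card : ℝ) = N := by
    rw [← Nat.cast_sum, ← Finset.card_eq_sum_card_fiberwise (fun _ _ => Finset.mem_univ _),
      Finset.card_univ, Fintype.card_fin]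
  rw [← Finset.sum_div, Finset.sum_sub_distrib, Finset.sum_sub_distrib, hcardT, Finset.sum_const,
    Finset.sum_const, Finset.card_univ, nsmul_eq_mul, nsmul_eq_mul, hcardz]
  have hNR : (N : ℝ) = 4 * (n * B) := by
    rw [hN, hB]
    push_cast
    ring
  rw [hNR]
  field_simp
  ring

-- A strict inversion on a line in direction `j` changes coordinate `j` alone, so no line in another
-- direction contains the pair; summing over directions counts it once.
open Classical in
theorem sum_lines_le {D : ℕ} (hf : LocallySeparating f D) (a b : Fin N) :
    (∑ j, if lineIndex f j b = lineIndex f j a then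
      inversionWeight (fun u => (f u j : ℕ)) a b else 0) ≤
      if (a : ℕ) + D < b ∧ f b ≤ f a then 1 / ((b : ℝ) - a) else 0 := by
  by_cases h : ∃ j, lineIndex f j b = lineIndex f j a ∧ a < b ∧ f b j < f a j
  · obtain ⟨j, hj, hab, hlt⟩ := h
    have hle := le_of_lineIndex_eq hj hlt.le
    have hfar : (a : ℕ) + D < b := not_le.1 fun hcon => hf a b hab hcon hle
    rw [Finset.sum_eq_single j]
    · rw [if_pos hj, if_pos ⟨hfar, hle⟩, inversionWeight, if_pos ⟨hab, hlt⟩]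
    · intro i _ hij
      refine if_neg fun hi => hlt.ne ?_
      exact congrFun hi ⟨j, hij.symm⟩
    · simp
  · rw [Finset.sum_eq_zero]
    · split_ifs with hc
      · have : (a : ℝ) < b := by exact_mod_cast (by omega : (a : ℕ) < b)
        exact div_nonneg zero_le_one (by linarith)
      · exact le_rfl
    · intro j _
      split_ifs with hj
      · exact if_neg fun hab => h ⟨j, hj, hab.1, hab.2⟩
      · rfl

theorem le_sum_farPairs {B : ℕ} (hB : B = n ^ p) (hn : 0 < n) (hN : N = 4 * n ^ (p + 1))
    (hf : LocallySeparating f (4 * B)) (P : Fin N × Fin N → Prop) [DecidablePred P]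
    (hP : ∀ e, P e ↔ f e.2 ≤ f e.1) :
    (p + 1) * ((n : ℝ) / 16) ≤ ∑ e ∈ farPairs N (4 * B) with P e, 1 / ((e.2 : ℝ) - e.1) := by
  classical
  calc (p + 1) * ((n : ℝ) / 16) = ∑ _j : Fin (p + 1), (n : ℝ) / 16 := by simp
    _ ≤ ∑ j : Fin (p + 1), ∑ a, ∑ b, if lineIndex f j b = lineIndex f j a then
          inversionWeight (fun u => (f u j : ℕ)) a b else 0 :=
        Finset.sum_le_sum fun j _ => div_le_sum_lines hB hn hN hf j
    _ = ∑ a, ∑ b, ∑ j : Fin (p + 1), if lineIndex f j b = lineIndex f j a then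
          inversionWeight (fun u => (f u j : ℕ)) a b else 0 := by
        rw [Finset.sum_comm]
        exact Finset.sum_congr rfl fun a _ => Finset.sum_comm
    _ ≤ ∑ a : Fin N, ∑ b : Fin N, if (a : ℕ) + 4 * B < b ∧ f b ≤ f a then 1 / ((b : ℝ) - a) else 0 :=
        Finset.sum_le_sum fun a _ => Finset.sum_le_sum fun b _ => sum_lines_le hf a b
    _ = _ := by
        rw [farPairs, Finset.filter_filter, Finset.sum_filter, Fintype.sum_prod_type]
        refine Finset.sum_congr rfl fun a _ => Finset.sum_congr rfl fun b _ => ?_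
        simp only [hP]

end Lines

/-! ### Construction for the upper bound -/

/-- The graph whose edges are the pairs at distance at most `D` and the pairs from `S`. -/
def localGraph {N : ℕ} (D : ℕ) (S : Finset (Fin N × Fin N)) : SimpleGraph (Fin N) :=
  SimpleGraph.fromRel fun u v => (u < v ∧ (v : ℕ) ≤ u + D) ∨ (u, v) ∈ S

theorem ncard_edgeSet_localGraph_le {N : ℕ} (D : ℕ) (S : Finset (Fin N × Fin N)) :
    (localGraph D S).edgeSet.ncard ≤ N * D + S.card := by
  classical
  set L : Finset (Fin N × Fin N) := Finset.univ.filter fun e => e.1 < e.2 ∧ (e.2 : ℕ) ≤ e.1 + D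
  have hL : L.card ≤ N * D := by
    calc L.card ≤ ((Finset.univ : Finset (Fin N)) ×ˢ Finset.range D).card := by
          refine Finset.card_le_card_of_injOn (fun e => (e.1, (e.2 : ℕ) - e.1 - 1)) ?_ ?_
          · rintro ⟨u, v⟩ he
            have h : u < v ∧ (v : ℕ) ≤ u + D := by simpa [L] using he
            have h1 : (u : ℕ) < v := h.1
            simp only [Finset.coe_product, Set.mem_prod, Finset.coe_univ, Set.mem_univ, true_and,
              Finset.coe_range, Set.mem_Iio]
            omega
          · rintro ⟨u, v⟩ he ⟨u', v'⟩ he' hee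
            have h : u < v ∧ (v : ℕ) ≤ u + D := by simpa [L] using he
            have h' : u' < v' ∧ (v' : ℕ) ≤ u' + D := by simpa [L] using he'
            simp only [Prod.mk.injEq] at hee
            obtain ⟨rfl, h2⟩ := hee
            have h1 : (u : ℕ) < v := h.1
            have h1' : (u : ℕ) < v' := h'.1
            refine Prod.ext rfl (Fin.ext ?_)
            simp only
            omega
      _ = N * D := by simp
  have hsub : (localGraph D S).edgeSet ⊆
      ((L ∪ S).image fun e => s(e.1, e.2) : Finset (Sym2 (Fin N))) := by
    intro e he
    induction e using Sym2.ind with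
    | _ u v =>
      have he' : (localGraph D S).Adj u v := he
      rw [localGraph, SimpleGraph.fromRel_adj] at he'
      simp only [Finset.coe_image, Set.mem_image, Finset.mem_coe, Finset.mem_union]
      rcases he'.2 with h | h
      · exact ⟨(u, v), by simpa [L] using h, rfl⟩
      · exact ⟨(v, u), by simpa [L] using h, Sym2.eq_swap⟩
  calc (localGraph D S).edgeSet.ncard
      ≤ ((L ∪ S).image fun e => s(e.1, e.2)).card := by
        rw [← Set.ncard_coe_finset]
        exact Set.ncard_le_ncard hsub (Set.toFinite _)
    _ ≤ (L ∪ S).card := Finset.card_image_le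
    _ ≤ L.card + S.card := Finset.card_union_le _ _
    _ ≤ _ := by omega

theorem exists_arrowsOrderedPath (n p : ℕ) (hn : 2 ≤ n) :
    ∃ (N : ℕ) (G : SimpleGraph (Fin N)), ArrowsOrderedPath G n (p + 1) ∧
      (G.edgeSet.ncard : ℝ) ≤
        16 * (n : ℝ) ^ (2 * p + 1) + 256 * (n : ℝ) ^ (2 * p + 1) * Real.log n ^ 2 + 1 := by
  classical
  obtain ⟨N, hN⟩ : ∃ N, N = 4 * n ^ (p + 1) := ⟨_, rfl⟩
  obtain ⟨B, hB⟩ : ∃ B, B = n ^ p := ⟨_, rfl⟩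
  have hn0 : 0 < n := by omega
  have hnR : (0 : ℝ) < n := by exact_mod_cast hn0
  have hB0 : 0 < B := by rw [hB]; positivity
  have hBR : (0 : ℝ) < B := by exact_mod_cast hB0
  have hNB : N = n * (4 * B) := by rw [hN, hB]; ring
  have hNR : (N : ℝ) = n * (4 * B) := by exact_mod_cast hNB
  have hBp : (B : ℝ) = n ^ p := by exact_mod_cast hB
  have hlog : 0 ≤ Real.log n := Real.log_natCast_nonneg n
  set F : Finset (Fin N → Fin (p + 1) → Fin n) :=
    Finset.univ.filter fun f => LocallySeparating f (4 * B) with hF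
  have hX : ∑ e ∈ farPairs N (4 * B), 1 / ((e.2 : ℝ) - e.1) ≤ N * Real.log n := by
    have h := sum_farPairs_le (N := N) (D := 4 * B) (by omega) (by rw [hNB]; nlinarith)
    have h2 : (N : ℝ) / ((4 * B : ℕ) : ℝ) = n := by
      rw [hNR]
      push_cast
      field_simp
    rwa [h2] at h
  have hΛ : Real.log F.card ≤ N * ((p + 1) * Real.log n) := by
    have hle : F.card ≤ (n ^ (p + 1)) ^ N := by
      refine (Finset.card_le_univ F).trans (le_of_eq ?_)
      simp
    rcases Nat.eq_zero_or_pos F.card with h0 | hpos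
    · rw [h0, Nat.cast_zero, Real.log_zero]
      positivity
    · calc Real.log F.card ≤ Real.log (((n ^ (p + 1)) ^ N : ℕ) : ℝ) :=
            Real.log_le_log (by exact_mod_cast hpos) (by exact_mod_cast hle)
        _ = _ := by
            push_cast
            rw [Real.log_pow, Real.log_pow]
            push_cast
            ring
  obtain ⟨S, hSE, hScard, hS⟩ := exists_hitting_set (farPairs N (4 * B))
    (fun e => 1 / ((e.2 : ℝ) - e.1)) (fun e he => by
      have h : (e.1 : ℕ) + 4 * B < e.2 := (Finset.mem_filter.1 he).2
      have : (e.1 : ℝ) < e.2 := by exact_mod_cast (by omega : (e.1 : ℕ) < e.2)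
      exact div_pos one_pos (by linarith)) F (fun f e => f e.2 ≤ f e.1)
    (W := (p + 1) * ((n : ℝ) / 16)) (by positivity) hX
    (fun f hf P _ hP => le_sum_farPairs hB hn0 hN (Finset.mem_filter.1 hf).2 P hP) hΛ
    (by positivity)
  refine ⟨N, localGraph (4 * B) S, ?_, ?_⟩
  · by_contra hcon
    obtain ⟨g, hgn, hg⟩ := exists_isSeparating_of_not_arrows hcon
    let f : Fin N → Fin (p + 1) → Fin n := fun v c => ⟨g v c, hgn v c⟩
    have hnot : ∀ u v, u < v → (localGraph (4 * B) S).Adj u v → ¬ f v ≤ f u := by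
      intro u v huv hadj hle
      obtain ⟨c, hc⟩ := hg u v huv hadj
      exact absurd (hle c) (not_le.2 hc)
    have hfF : f ∈ F := by
      refine Finset.mem_filter.2 ⟨Finset.mem_univ _, fun u v huv hD => hnot u v huv ?_⟩
      rw [localGraph, SimpleGraph.fromRel_adj]
      exact ⟨huv.ne, Or.inl (Or.inl ⟨huv, hD⟩)⟩
    obtain ⟨e, heS, he⟩ := hS f hfF
    have hfar : (e.1 : ℕ) + 4 * B < e.2 := (Finset.mem_filter.1 (hSE heS)).2
    have hlt : e.1 < e.2 := Fin.lt_def.2 (by omega)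
    refine hnot e.1 e.2 hlt ?_ he
    rw [localGraph, SimpleGraph.fromRel_adj]
    exact ⟨hlt.ne, Or.inl (Or.inr heS)⟩
  · have h1 : ((localGraph (4 * B) S).edgeSet.ncard : ℝ) ≤ N * (4 * B) + S.card := by
      exact_mod_cast ncard_edgeSet_localGraph_le (4 * B) S
    refine h1.trans ?_
    -- The number of colours `p + 1` cancels between the weight `W` and the logarithm of the number
    -- of maps.
    have h2 : (N : ℝ) * Real.log n / ((p + 1) * (n / 16)) * (N * ((p + 1) * Real.log n)) =
        256 * (n : ℝ) ^ (2 * p + 1) * Real.log n ^ 2 := by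
      rw [hNR, hBp]
      field_simp
      ring
    have h3 : (N : ℝ) * (4 * B) = 16 * (n : ℝ) ^ (2 * p + 1) := by
      rw [hNR, hBp]
      ring
    rw [h2] at hScard
    linarith

theorem theorem3 :
    ∃ C : ℝ, 0 < C ∧ ∀ n q : ℕ, 2 ≤ n → 2 ≤ q →
      (n : ℝ) ^ (2 * q - 1) / (2 ^ (2 * q - 1) * (Nat.factorial (q - 1) : ℝ)) ≤
        (orderedSizeRamsey n q : ℝ) ∧
      (orderedSizeRamsey n q : ℝ) ≤ C * (n : ℝ) ^ (2 * q - 1) * Real.log n ^ 3 := by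
  refine ⟨1000, by norm_num, fun n q hn hq => ?_⟩
  obtain ⟨p, rfl⟩ : ∃ p, q = p + 2 := ⟨q - 2, by omega⟩
  obtain ⟨N, G, hG, hcard⟩ := exists_arrowsOrderedPath n (p + 1) hn
  have hmem : G.edgeSet.ncard ∈ {m : ℕ | ∃ (N : ℕ) (G : SimpleGraph (Fin N)),
      ArrowsOrderedPath G n (p + 2) ∧ G.edgeSet.ncard = m} := ⟨N, G, hG, rfl⟩
  have he : 2 * (p + 2) - 1 = 2 * p + 3 := by omega
  have he' : p + 2 - 1 = p + 1 := by omega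
  rw [he, he']
  constructor
  -- The graph from the upper bound makes the set nonempty, so the infimum is attained and is not
  -- the default 0.
  · obtain ⟨N', G', hG', hm⟩ := Nat.sInf_mem ⟨_, hmem⟩
    refine (half_pow_le_choose_mul_pow hn).trans (Nat.cast_le.2 ?_)
    rw [orderedSizeRamsey, ← hm]
    have hsplit : n = (n / 2 - 1) + 1 + (n - n / 2) := by omega
    rw [hsplit] at hG'
    exact hG'.mul_le_ncard_edgeSet
  · have h1 : (orderedSizeRamsey n (p + 2) : ℝ) ≤ G.edgeSet.ncard :=
      Nat.cast_le.2 (Nat.sInf_le hmem)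
    refine (h1.trans hcard).trans ?_
    rw [show 2 * (p + 1) + 1 = 2 * p + 3 by ring]
    have hL : 0.69 ≤ Real.log n := by
      have h2 : Real.log 2 ≤ Real.log n :=
        Real.log_le_log (by norm_num) (by exact_mod_cast hn)
      linarith [Real.log_two_gt_d9]
    have hx : (1 : ℝ) ≤ (n : ℝ) ^ (2 * p + 3) :=
      one_le_pow₀ (by exact_mod_cast (by omega : 1 ≤ n))
    set x := (n : ℝ) ^ (2 * p + 3)
    set L := Real.log n
    -- As `log n ≥ 0.69`, the spare logarithm absorbs the constant and quadratic terms.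
    have h3 : 17 + 256 * L ^ 2 ≤ 1000 * L ^ 3 := by nlinarith [sq_nonneg (L - 0.69)]
    calc 16 * x + 256 * x * L ^ 2 + 1 ≤ x * (17 + 256 * L ^ 2) := by linarith
      _ ≤ x * (1000 * L ^ 3) := by gcongr
      _ = _ := by ring
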